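/- Let $c>0$, $\lambda>0$ and $t>0$. For $\nu\ge 0$ let $$X_\nu(t)=c\sum_{j=1}^{N(t)+1}(s_j-s_{j-1})\cos\theta_j ,$$ where $N$ is a homogeneous Poisson process of rate $\lambda$, $s_1<\dots<s_{N(t)}$ are the times of its events in $[0,t]$, $s_0=0$, $s_{N(t)+1}=t$, and $\theta_1,\theta_2,\dots$ are independent random variables, independent of $N$, with common density $f_\nu(\theta)=\frac{\Gamma(\nu+1)}{\sqrt{\pi}\,\Gamma(\nu+\frac12)}\sin^{2\nu}\theta$ on $(0,\pi)$. For $x>0$ put $$I_\mu(x)=\sum_{k=0}^\infty\frac{(x/2)^{2k+\mu}}{\Gamma(k+1)\Gamma(k+\mu+1)},\qquad \mathbf L_\mu(x)=\sum_{k=0}^\infty\frac{(x/2)^{2k+\mu+1}}{\Gamma(k+\frac32)\Gamma(k+\mu+\frac32)},\qquad E_{\alpha,\beta}(x)=\sum_{k=0}^\infty\frac{x^k}{\Gamma(\alpha k+\beta)}$$ (the modified Bessel, modified Struve and Mittag-Leffler functions). Then for every integer $p\ge 0$ the $p$-th moments of $X_0(t)$ and $X_1(t)$ exist. If $p$ is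 even, $$E\{X_0^p(t)\}=e^{-\lambda t}\left(\frac{2}{\lambda t}\right)^{\frac{p-1}{2}}(ct)^{p}\,\Gamma\left(\frac{p+1}{2}\right)\left\{I_{\frac{p+1}{2}}(\lambda t)+\mathbf L_{\frac{p+1}{2}}(\lambda t)\right\}+\frac{e^{-\lambda t}(ct)^p\,\Gamma\left(\frac{p+1}{2}\right)}{\sqrt{\pi}\,\Gamma\left(\frac{p}{2}+1\right)},$$ $$E\{X_1^p(t)\}=\frac{e^{-\lambda t}}{\sqrt{\pi}}\,\Gamma\left(\frac{p+1}{2}\right)(ct)^p\left\{E_{1,\frac p2+1}(\lambda t)-\frac p2\,E_{1,\frac p2+2}(\lambda t)\right\},$$ and if $p$ is odd, $E\{X_0^p(t)\}=E\{X_1^p(t)\}=0$. -/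

import Mathlib

open MeasureTheory ProbabilityTheory

noncomputable section

/-! ### Special functions -/

/-- The modified Bessel function of the first kind
`I_μ(x) = ∑ₖ (x/2)^(2k+μ) / (Γ(k+1) Γ(k+μ+1))`, for `x > 0`. -/
def modifiedBesselI (μ x : ℝ) : ℝ :=
  ∑' k : ℕ, (x / 2) ^ (2 * (k : ℝ) + μ) /
    (Real.Gamma ((k : ℝ) + 1) * Real.Gamma ((k : ℝ) + μ + 1))

/-- The modified Struve function
`L_μ(x) = ∑ₖ (x/2)^(2k+μ+1) / (Γ(k+3/2) Γ(k+μ+3/2))`, for `x > 0`. -/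
def modifiedStruveL (μ x : ℝ) : ℝ :=
  ∑' k : ℕ, (x / 2) ^ (2 * (k : ℝ) + μ + 1) /
    (Real.Gamma ((k : ℝ) + 3 / 2) * Real.Gamma ((k : ℝ) + μ + 3 / 2))

/-- The Mittag-Leffler function `E_{α,β}(x) = ∑ₖ x^k / Γ(αk+β)`. -/
def mittagLeffler (α β x : ℝ) : ℝ :=
  ∑' k : ℕ, x ^ k / Real.Gamma (α * (k : ℝ) + β)

/-! ### The law of the directions -/

/-- The density `f_ν(θ) = Γ(ν+1) / (√π Γ(ν+1/2)) · sin^{2ν} θ` on `(0, π)`. -/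
def directionDensity (ν θ : ℝ) : ℝ :=
  Real.Gamma (ν + 1) / (√Real.pi * Real.Gamma (ν + 1 / 2)) * Real.sin θ ^ (2 * ν)

/-- The law on the real line with density `f_ν` on `(0, π)` (and no mass elsewhere). -/
def directionLaw (ν : ℝ) : Measure ℝ :=
  (volume.restrict (Set.Ioo 0 Real.pi)).withDensity
    fun θ => ENNReal.ofReal (directionDensity ν θ)

/-! ### The motion -/

section Motion

variable {Ω : Type*}

/-- The time `s_n = τ_1 + ⋯ + τ_n` of the `n`-th event (`s_0 = 0`), given the waiting times;
`τ i` is the waiting time between the events number `i` and `i + 1`. -/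
def eventTime (τ : ℕ → Ω → ℝ) (n : ℕ) (ω : Ω) : ℝ :=
  ∑ i ∈ Finset.range n, τ i ω

/-- The counting process `N(t)`: the number of events in `[0, t]`. -/
def eventCount (τ : ℕ → Ω → ℝ) (t : ℝ) (ω : Ω) : ℕ :=
  {n : ℕ | 1 ≤ n ∧ eventTime τ n ω ≤ t}.ncard

/-- The instants `s_0 = 0, s_1, …, s_{N(t)}, s_{N(t)+1} = t` which cut `[0, t]` into the pieces
on which the velocity is constant. -/
def switchTime (τ : ℕ → Ω → ℝ) (t : ℝ) (j : ℕ) (ω : Ω) : ℝ :=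
  if j ≤ eventCount τ t ω then eventTime τ j ω else t

/-- The position `c ∑_{j=1}^{N(t)+1} (s_j - s_{j-1}) cos θ_j`; the sequence `θ` is indexed
from `0`, that is, `θ j` is the direction between the switching times number `j` and `j + 1`. -/
def position (c : ℝ) (τ θ : ℕ → Ω → ℝ) (t : ℝ) (ω : Ω) : ℝ :=
  c * ∑ j ∈ Finset.range (eventCount τ t ω + 1),
    (switchTime τ t (j + 1) ω - switchTime τ t j ω) * Real.cos (θ j ω)

/-- The `τ i` are the waiting times of a homogeneous Poisson process of rate `lam`: they are
independent and exponentially distributed with parameter `lam`. -/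
structure ArePoissonWaitingTimes [MeasurableSpace Ω] (lam : ℝ) (τ : ℕ → Ω → ℝ)
    (P : Measure Ω) : Prop where
  measurable : ∀ i, Measurable (τ i)
  law : ∀ i, P.map (τ i) = expMeasure lam
  indep : iIndepFun τ P

/-- The `θ j` are independent with the common density `f_ν` on `(0, π)`. -/
structure AreDirections [MeasurableSpace Ω] (ν : ℝ) (θ : ℕ → Ω → ℝ)
    (P : Measure Ω) : Prop where
  measurable : ∀ j, Measurable (θ j)
  law : ∀ j, P.map (θ j) = directionLaw ν
  indep : iIndepFun θ P

/-- `X` is the random motion `X_ν` with parameter `ν`, speed scale `c` and rate `lam`: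
it has the form `X(t) = c ∑_{j=1}^{N(t)+1} (s_j - s_{j-1}) cos θ_j` for `t > 0`, where `N` is a
homogeneous Poisson process of rate `lam` with event times `s_j`, and the `θ_j` are independent
with density `f_ν` and independent of the Poisson process. -/
def IsMotion [MeasurableSpace Ω] (ν c lam : ℝ) (X : ℝ → Ω → ℝ) (P : Measure Ω) : Prop :=
  ∃ τ θ : ℕ → Ω → ℝ,
    ArePoissonWaitingTimes lam τ P ∧
    AreDirections ν θ P ∧
    IndepFun (fun ω i => τ i ω) (fun ω j => θ j ω) P ∧
    ∀ t, 0 < t → ∀ ω, X t ω = position c τ θ t ω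

end Motion

end

noncomputable section

open scoped Nat

/-! Split according to the number `n` of events up to time `t`. With the velocities `a j = cos θ_j`
frozen, the `n + 1` pieces of `[0, t]` are uniform spacings, so the `p`-th moment on this event is a
Dirichlet moment: a factor times the complete homogeneous symmetric polynomial `h_p(a 0, …, a n)`
(`setIntegral_displacement_pow`). Averaging over independent directions turns `h_p` into the
coefficient of `z^p` in `M_ν(z)^(n+1)`, where `M_ν(z) = ∑ E(cos^k θ) z^k`
(`integral_completeSymm_cos`). Hence the moment is an explicit series in `λt`
(`IsMotion.integrable_and_hasSum`).

For `ν = 0`, `M = (1 - z²)^(-1/2)`; by the duplication formula the series is of Bessel type, its odd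
`n` giving `I`, its even `n ≥ 2` giving `L`, and `n = 0` the remaining term. For `ν = 1`, `M` is the
Catalan series at `z²/4`; the coefficients of its powers are ballot numbers, and the series splits
into two Mittag-Leffler functions. Both `M` are even in `z`, so odd moments vanish. -/

/-! ### Sequences of independent variables, the Beta integral, the exponential law. -/

theorem infinitePi_map_head_tail {E : Type*} [MeasurableSpace E] (μ : Measure E)
    [IsProbabilityMeasure μ] :
    (Measure.infinitePi fun _ : ℕ => μ).map (fun x => (x 0, fun i => x (i + 1))) =
      μ.prod (Measure.infinitePi fun _ : ℕ => μ) := by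
  have hind : iIndepFun (fun (i : ℕ) (x : ℕ → E) => x i) (Measure.infinitePi fun _ : ℕ => μ) :=
    iIndepFun_infinitePi (P := fun _ : ℕ => μ) (X := fun _ x => x) (fun _ => measurable_id)
  have hdisj : Disjoint ({0} : Set ℕ) (Set.Ici 1) := by simp
  have h := indep_iSup_of_disjoint (fun i => (measurable_pi_apply i).comap_le) hind.iIndep hdisj
  have hht : IndepFun (fun x : ℕ → E => x 0) (fun x i => x (i + 1))
      (Measure.infinitePi fun _ : ℕ => μ) := by
    rw [IndepFun_iff_Indep]
    refine indep_of_indep_of_le_left (indep_of_indep_of_le_right h ?_) ?_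
    · rw [MeasurableSpace.pi, MeasurableSpace.comap_iSup]
      refine iSup_le fun i => ?_
      rw [MeasurableSpace.comap_comp]
      exact le_iSup₂_of_le (i + 1) (by simp) le_rfl
    · exact le_iSup₂_of_le 0 (by simp) le_rfl
  rw [hht.map_prod_eq_prod_map_map (Measurable.aemeasurable (by fun_prop))
      (Measurable.aemeasurable (by fun_prop)),
    Measure.infinitePi_map_eval (fun _ : ℕ => μ) 0,
    Measure.map_infinitePi_infinitePi_of_inj (P := fun _ : ℕ => μ) (add_left_injective 1)]

/-- Conditioning on the first variable. The bound is only almost sure because it will rely on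
waiting times being nonnegative. -/
theorem integral_infinitePi_eq_integral_integral {E : Type*} [MeasurableSpace E] (μ : Measure E)
    [IsProbabilityMeasure μ] {f : E → (ℕ → E) → ℝ} (hf : Measurable (Function.uncurry f))
    {C : ℝ} (hC : ∀ᵐ x ∂(Measure.infinitePi fun _ : ℕ => μ), |f (x 0) (fun i => x (i + 1))| ≤ C) :
    ∫ x, f (x 0) (fun i => x (i + 1)) ∂(Measure.infinitePi fun _ : ℕ => μ) =
      ∫ s, ∫ x, f s x ∂(Measure.infinitePi fun _ : ℕ => μ) ∂μ := by
  have hm : Measurable fun x : ℕ → E => (x 0, fun i => x (i + 1)) := by fun_prop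
  have h1 := integral_map (μ := Measure.infinitePi fun _ : ℕ => μ) hm.aemeasurable
    (f := Function.uncurry f) hf.aestronglyMeasurable
  simp only [Function.uncurry] at h1
  rw [← h1, infinitePi_map_head_tail]
  refine integral_prod (Function.uncurry f) ?_
  refine Integrable.of_bound hf.aestronglyMeasurable C ?_
  rw [← infinitePi_map_head_tail]
  rw [ae_map_iff hm.aemeasurable]
  · exact hC
  · exact measurableSet_le (by fun_prop) measurable_const

/-- A Beta integral; each integration by parts moves one power from `t - s` to `s`, with vanishing
boundary terms. -/
theorem integral_pow_mul_sub_pow (t : ℝ) (k m : ℕ) :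
    ∫ s in (0 : ℝ)..t, s ^ k * (t - s) ^ m =
      (k ! : ℝ) * m ! / (k + m + 1)! * t ^ (k + m + 1) := by
  induction m generalizing k with
  | zero =>
    simp only [pow_zero, mul_one, integral_pow, add_zero, Nat.factorial_succ, Nat.factorial_zero]
    have := Nat.factorial_ne_zero k
    push_cast
    field_simp
    simp
  | succ m ih =>
    have hu : ∀ x ∈ Set.uIcc 0 t,
        HasDerivAt (fun x => (t - x) ^ (m + 1)) (-((m + 1) * (t - x) ^ m)) x := fun x _ => by
      have := ((hasDerivAt_id x).const_sub t).pow (m + 1)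
      exact this.congr_deriv (by simp)
    have hv : ∀ x ∈ Set.uIcc 0 t,
        HasDerivAt (fun x : ℝ => x ^ (k + 1) / (k + 1)) (x ^ k) x := fun x _ => by
      have := (hasDerivAt_pow (k + 1) x).div_const ((k : ℝ) + 1)
      refine this.congr_deriv ?_
      have : (k : ℝ) + 1 ≠ 0 := by positivity
      push_cast
      field_simp
    have h := intervalIntegral.integral_mul_deriv_eq_deriv_mul hu hv
      (Continuous.intervalIntegrable (by fun_prop) _ _)
      (Continuous.intervalIntegrable (by fun_prop) _ _)
    have h2 : ∫ x in (0 : ℝ)..t, -((m + 1) * (t - x) ^ m) * (x ^ (k + 1) / (k + 1)) =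
        -((m + 1) / (k + 1)) * ∫ x in (0 : ℝ)..t, x ^ (k + 1) * (t - x) ^ m := by
      rw [← intervalIntegral.integral_const_mul]
      congr 1
      ext x
      ring
    rw [h2, ih] at h
    calc ∫ s in (0 : ℝ)..t, s ^ k * (t - s) ^ (m + 1)
        = ∫ s in (0 : ℝ)..t, (t - s) ^ (m + 1) * s ^ k := by simp only [mul_comm]
      _ = _ := by
        rw [h]
        have e : k + 1 + m + 1 = k + (m + 1) + 1 := by ring
        rw [e, Nat.factorial_succ k, Nat.factorial_succ m]
        have : (k : ℝ) + 1 ≠ 0 := by positivity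
        have := Nat.factorial_ne_zero (k + (m + 1) + 1)
        push_cast
        simp
        field_simp

theorem integral_expMeasure {lam : ℝ} (hlam : 0 < lam) (f : ℝ → ℝ) :
    ∫ s, f s ∂(expMeasure lam) = ∫ s in Set.Ioi 0, lam * Real.exp (-(lam * s)) * f s := by
  have hd : expMeasure lam = volume.withDensity (exponentialPDF lam) := rfl
  have hm : Measurable (exponentialPDF lam) :=
    (measurable_exponentialPDFReal lam).ennreal_ofReal
  rw [hd, integral_withDensity_eq_integral_toReal_smul hm
      (by simp [exponentialPDF]),
    ← integral_indicator measurableSet_Ioi]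
  refine integral_congr_ae ?_
  -- `exponentialPDF` equals `lam` at `0`, which the open half-line omits.
  have h0 : ∀ᵐ s : ℝ, s ≠ 0 := by simp [ae_iff]
  filter_upwards [h0] with s hs
  rw [exponentialPDF_eq]
  by_cases h : 0 < s
  · have : 0 ≤ lam * Real.exp (-(lam * s)) := by positivity
    simp [h, h.le, ENNReal.toReal_ofReal this]
  · have h' : ¬ 0 ≤ s := fun h' => h (lt_of_le_of_ne h' hs.symm)
    simp [h, h']

theorem ae_nonneg_expMeasure (lam : ℝ) : ∀ᵐ s ∂(expMeasure lam), 0 ≤ s := by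
  have hd : expMeasure lam = volume.withDensity (exponentialPDF lam) := rfl
  have hm : Measurable (exponentialPDF lam) :=
    (measurable_exponentialPDFReal lam).ennreal_ofReal
  rw [hd, ae_withDensity_iff hm]
  refine Filter.Eventually.of_forall fun s hs => ?_
  by_contra h
  exact hs (exponentialPDF_of_neg (not_le.1 h))

theorem measureReal_expMeasure_Ioi {lam t : ℝ} (hlam : 0 < lam) (ht : 0 ≤ t) :
    (expMeasure lam).real (Set.Ioi t) = Real.exp (-(lam * t)) := by
  have := isProbabilityMeasure_expMeasure hlam
  have h := cdf_expMeasure_eq hlam t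
  rw [if_pos ht, cdf_eq_real] at h
  rw [← Set.compl_Iic, probReal_compl_eq_one_sub measurableSet_Iic, h]
  ring

/-! ### Moments of the displacement with frozen velocities. -/

/-- The waiting times `x` for which exactly `n` events have occurred at time `t`. -/
def holdingSet (n : ℕ) (t : ℝ) : Set (ℕ → ℝ) :=
  {x | ∑ i ∈ Finset.range n, x i ≤ t ∧ t < ∑ i ∈ Finset.range (n + 1), x i}

/-- The displacement at time `t` with waiting times `x` and velocities `a`, if exactly `n` events
have occurred. -/
def displacement (n : ℕ) (t : ℝ) (a x : ℕ → ℝ) : ℝ :=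
  ∑ j ∈ Finset.range n, x j * a j + (t - ∑ i ∈ Finset.range n, x i) * a n

/-- The complete homogeneous symmetric polynomial of degree `p` in `a 0, …, a (n - 1)`. -/
def completeSymm (n p : ℕ) (a : ℕ → ℝ) : ℝ :=
  PowerSeries.coeff p (∏ j ∈ Finset.range n, PowerSeries.mk fun k => a j ^ k)

theorem completeSymm_one (p : ℕ) (a : ℕ → ℝ) : completeSymm 1 p a = a 0 ^ p := by
  simp [completeSymm]

/-- Cauchy product with the factor of index `0` split off, the same recursion as conditioning on the
first waiting time. -/
theorem completeSymm_succ (n p : ℕ) (a : ℕ → ℝ) :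
    completeSymm (n + 1) p a = ∑ q ∈ Finset.HasAntidiagonal.antidiagonal p,
      a 0 ^ q.1 * completeSymm n q.2 (fun j => a (j + 1)) := by
  rw [completeSymm, Finset.prod_range_succ', mul_comm, PowerSeries.coeff_mul]
  simp [completeSymm]

theorem measurableSet_holdingSet (n : ℕ) (t : ℝ) : MeasurableSet (holdingSet n t) := by
  have h : holdingSet n t = {x | ∑ i ∈ Finset.range n, x i ≤ t} ∩
      {x | t < ∑ i ∈ Finset.range (n + 1), x i} := rfl
  rw [h]
  exact (measurableSet_le (by fun_prop) (by fun_prop)).inter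
    (measurableSet_lt (by fun_prop) (by fun_prop))

theorem measurable_displacement (n : ℕ) (t : ℝ) (a : ℕ → ℝ) :
    Measurable (displacement n t a) := by
  unfold displacement
  fun_prop

/-- Renewal at the first event: the remaining waiting times have time `t - x 0` left. -/
theorem mem_holdingSet_succ (n : ℕ) (t : ℝ) (x : ℕ → ℝ) :
    x ∈ holdingSet (n + 1) t ↔ (fun i => x (i + 1)) ∈ holdingSet n (t - x 0) := by
  simp only [holdingSet, Set.mem_ofPred_eq, Finset.sum_range_succ' x, le_sub_iff_add_le,
    sub_lt_iff_lt_add]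

theorem displacement_succ (n : ℕ) (t : ℝ) (a x : ℕ → ℝ) :
    displacement (n + 1) t a x = x 0 * a 0 +
      displacement n (t - x 0) (fun i => a (i + 1)) (fun i => x (i + 1)) := by
  simp only [displacement, Finset.sum_range_succ']
  ring

/-- The weights of the velocities are nonnegative and sum to `t`. -/
theorem abs_displacement_le {n : ℕ} {t : ℝ} {a x : ℕ → ℝ} (ha : ∀ j, |a j| ≤ 1)
    (hx : ∀ i, 0 ≤ x i) (hm : x ∈ holdingSet n t) : |displacement n t a x| ≤ t := by
  have h0 : 0 ≤ t - ∑ i ∈ Finset.range n, x i := sub_nonneg.2 hm.1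
  calc |displacement n t a x|
      ≤ ∑ j ∈ Finset.range n, |x j * a j| + |(t - ∑ i ∈ Finset.range n, x i) * a n| :=
        (abs_add_le _ _).trans (add_le_add_left (Finset.abs_sum_le_sum_abs _ _) _)
    _ ≤ ∑ j ∈ Finset.range n, x j + (t - ∑ i ∈ Finset.range n, x i) := by
        refine add_le_add (Finset.sum_le_sum fun j _ => ?_) ?_
        · rw [abs_mul, abs_of_nonneg (hx j)]
          exact mul_le_of_le_one_right (hx j) (ha j)
        · rw [abs_mul, abs_of_nonneg h0]
          exact mul_le_of_le_one_right h0 (ha n)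
    _ = t := by ring

section

variable {lam : ℝ} [IsProbabilityMeasure (expMeasure lam)]

theorem ae_nonneg_infinitePi_expMeasure :
    ∀ᵐ x ∂(Measure.infinitePi fun _ : ℕ => expMeasure lam), ∀ i, 0 ≤ x i := by
  rw [ae_all_iff]
  intro i
  have h := ae_nonneg_expMeasure lam
  rw [← Measure.infinitePi_map_eval (fun _ : ℕ => expMeasure lam) i] at h
  exact ae_of_ae_map (measurable_pi_apply i).aemeasurable h

theorem ae_abs_indicator_displacement_pow_le (n p : ℕ) {t : ℝ} (ht : 0 ≤ t) {a : ℕ → ℝ}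
    (ha : ∀ j, |a j| ≤ 1) :
    ∀ᵐ x ∂(Measure.infinitePi fun _ : ℕ => expMeasure lam),
      |(holdingSet n t).indicator (fun x => displacement n t a x ^ p) x| ≤ t ^ p := by
  filter_upwards [ae_nonneg_infinitePi_expMeasure] with x hx
  by_cases h : x ∈ holdingSet n t
  · rw [Set.indicator_of_mem h, abs_pow]
    exact pow_le_pow_left₀ (abs_nonneg _) (abs_displacement_le ha hx h) p
  · rw [Set.indicator_of_notMem h, abs_zero]
    positivity

theorem integrableOn_displacement_pow (n p : ℕ) {t : ℝ} (ht : 0 ≤ t) {a : ℕ → ℝ}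
    (ha : ∀ j, |a j| ≤ 1) :
    IntegrableOn (fun x => displacement n t a x ^ p) (holdingSet n t)
      (Measure.infinitePi fun _ : ℕ => expMeasure lam) := by
  rw [← integrable_indicator_iff (measurableSet_holdingSet n t)]
  exact Integrable.of_bound
    (((measurable_displacement n t a).pow_const p).indicator
      (measurableSet_holdingSet n t)).aestronglyMeasurable (t ^ p)
    (ae_abs_indicator_displacement_pow_le n p ht ha)

theorem measureReal_holdingSet_zero (hlam : 0 < lam) {t : ℝ} (ht : 0 ≤ t) :
    (Measure.infinitePi fun _ : ℕ => expMeasure lam).real (holdingSet 0 t) =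
      Real.exp (-(lam * t)) := by
  have h : holdingSet 0 t = (fun x : ℕ → ℝ => x 0) ⁻¹' Set.Ioi t := by
    ext x
    simp [holdingSet, ht]
  rw [← measureReal_expMeasure_Ioi hlam ht, h,
    ← map_measureReal_apply (measurable_pi_apply 0) measurableSet_Ioi,
    Measure.infinitePi_map_eval (fun _ : ℕ => expMeasure lam) 0]

theorem measurable_indicator_shifted_displacement (n p : ℕ) (t b : ℝ) (a : ℕ → ℝ) :
    Measurable (Function.uncurry fun (s : ℝ) (y : ℕ → ℝ) =>
      (holdingSet n (t - s)).indicator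
        (fun y => (s * b + displacement n (t - s) a y) ^ p) y) := by
  have hS : MeasurableSet {q : ℝ × (ℕ → ℝ) | q.2 ∈ holdingSet n (t - q.1)} := by
    have h : {q : ℝ × (ℕ → ℝ) | q.2 ∈ holdingSet n (t - q.1)} =
        {q | ∑ i ∈ Finset.range n, q.2 i ≤ t - q.1} ∩
          {q | t - q.1 < ∑ i ∈ Finset.range (n + 1), q.2 i} := rfl
    rw [h]
    exact (measurableSet_le (by fun_prop) (by fun_prop)).inter
      (measurableSet_lt (by fun_prop) (by fun_prop))
  have hf : Measurable fun q : ℝ × (ℕ → ℝ) =>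
      (q.1 * b + displacement n (t - q.1) a q.2) ^ p := by
    unfold displacement
    fun_prop
  exact hf.indicator hS

theorem setIntegral_displacement_pow_succ (n p : ℕ) {t : ℝ} (ht : 0 ≤ t) {a : ℕ → ℝ}
    (ha : ∀ j, |a j| ≤ 1) :
    ∫ x in holdingSet (n + 1) t, displacement (n + 1) t a x ^ p
        ∂(Measure.infinitePi fun _ : ℕ => expMeasure lam) =
      ∫ s, ∫ y in holdingSet n (t - s),
        (s * a 0 + displacement n (t - s) (fun i => a (i + 1)) y) ^ p
          ∂(Measure.infinitePi fun _ : ℕ => expMeasure lam) ∂(expMeasure lam) := by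
  have hfun : (holdingSet (n + 1) t).indicator (fun x => displacement (n + 1) t a x ^ p) =
      fun x => (fun (s : ℝ) (y : ℕ → ℝ) => (holdingSet n (t - s)).indicator
        (fun y => (s * a 0 + displacement n (t - s) (fun i => a (i + 1)) y) ^ p) y)
          (x 0) (fun i => x (i + 1)) := by
    funext x
    by_cases h : x ∈ holdingSet (n + 1) t
    · have h' := (mem_holdingSet_succ n t x).1 h
      simp only [Set.indicator_of_mem h, Set.indicator_of_mem h', displacement_succ]
    · have h' := fun h' => h ((mem_holdingSet_succ n t x).2 h')
      simp only [Set.indicator_of_notMem h, Set.indicator_of_notMem h']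
  have hbd := ae_abs_indicator_displacement_pow_le (lam := lam) (n + 1) p ht ha
  rw [hfun] at hbd
  rw [← integral_indicator (measurableSet_holdingSet _ _), hfun,
    integral_infinitePi_eq_integral_integral _
      (measurable_indicator_shifted_displacement n p t (a 0) fun i => a (i + 1)) hbd]
  congr 1
  ext s
  exact integral_indicator (measurableSet_holdingSet _ _)

/-- Removes first waiting times longer than `t` from the renewal integral. -/
theorem setIntegral_holdingSet_of_neg (n : ℕ) {t : ℝ} (ht : t < 0) (f : (ℕ → ℝ) → ℝ) :
    ∫ x in holdingSet n t, f x ∂(Measure.infinitePi fun _ : ℕ => expMeasure lam) = 0 := by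
  refine setIntegral_eq_zero_of_ae_eq_zero ?_
  filter_upwards [ae_nonneg_infinitePi_expMeasure] with x hx hm
  exact absurd (hm.1.trans_lt ht) (not_lt.2 (Finset.sum_nonneg fun i _ => hx i))

theorem setIntegral_add_displacement_pow (n p : ℕ) (b : ℝ) {t : ℝ} (ht : 0 ≤ t) {a : ℕ → ℝ}
    (ha : ∀ j, |a j| ≤ 1) :
    ∫ y in holdingSet n t, (b + displacement n t a y) ^ p
        ∂(Measure.infinitePi fun _ : ℕ => expMeasure lam) =
      ∑ q ∈ Finset.HasAntidiagonal.antidiagonal p, (p.choose q.1 : ℝ) * b ^ q.1 *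
        ∫ y in holdingSet n t, displacement n t a y ^ q.2
          ∂(Measure.infinitePi fun _ : ℕ => expMeasure lam) := by
  simp only [(Commute.all b _).add_pow', nsmul_eq_mul, ← mul_assoc]
  rw [integral_finsetSum _ fun q _ => (integrableOn_displacement_pow n q.2 ht ha).const_mul _]
  simp only [integral_const_mul]

/-- Induction by renewal: the exponentials combine to `exp (-(lam * t))`, the binomial theorem
separates the first piece, and its coefficients cancel against the factorials of the Beta integrals,
leaving the unweighted recursion `completeSymm_succ`. -/
theorem setIntegral_displacement_pow (hlam : 0 < lam) (n p : ℕ) {t : ℝ} (ht : 0 ≤ t)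
    {a : ℕ → ℝ} (ha : ∀ j, |a j| ≤ 1) :
    ∫ x in holdingSet n t, displacement n t a x ^ p
        ∂(Measure.infinitePi fun _ : ℕ => expMeasure lam) =
      lam ^ n * Real.exp (-(lam * t)) * t ^ (n + p) * (p ! / (n + p)!) *
        completeSymm (n + 1) p a := by
  induction n generalizing p t a with
  | zero =>
    have hp : (p ! : ℝ) ≠ 0 := by positivity
    simp [displacement, measureReal_holdingSet_zero hlam ht, completeSymm_one, mul_pow, hp]
    ring
  | succ n ih =>
    rw [setIntegral_displacement_pow_succ n p ht ha, integral_expMeasure hlam,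
      setIntegral_eq_of_subset_of_forall_sdiff_eq_zero measurableSet_Ioi
        (Set.Ioc_subset_Ioi_self : Set.Ioc 0 t ⊆ _), ← intervalIntegral.integral_of_le ht,
      completeSymm_succ, Finset.mul_sum]
    · have hcongr : ∀ s ∈ Set.uIcc 0 t, lam * Real.exp (-(lam * s)) *
          ∫ y in holdingSet n (t - s),
            (s * a 0 + displacement n (t - s) (fun i => a (i + 1)) y) ^ p
              ∂(Measure.infinitePi fun _ : ℕ => expMeasure lam) =
          ∑ q ∈ Finset.HasAntidiagonal.antidiagonal p,
            (lam ^ (n + 1) * Real.exp (-(lam * t)) * p.choose q.1 * a 0 ^ q.1 *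
              (q.2 ! / (n + q.2)!) * completeSymm (n + 1) q.2 (fun i => a (i + 1))) *
              (s ^ q.1 * (t - s) ^ (n + q.2)) := by
        intro s hs
        rw [Set.uIcc_of_le ht] at hs
        have hs' : 0 ≤ t - s := sub_nonneg.2 hs.2
        rw [setIntegral_add_displacement_pow n p _ hs' (fun j => ha (j + 1)), Finset.mul_sum]
        refine Finset.sum_congr rfl fun q _ => ?_
        have he : Real.exp (-(lam * t)) = Real.exp (-(lam * s)) * Real.exp (-(lam * (t - s))) := by
          rw [← Real.exp_add]
          ring_nf
        rw [ih q.2 hs' (fun j => ha (j + 1)), he, mul_pow]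
        ring
      rw [intervalIntegral.integral_congr hcongr, intervalIntegral.integral_finsetSum
        fun q _ => Continuous.intervalIntegrable (by fun_prop) _ _]
      refine Finset.sum_congr rfl fun q hq => ?_
      rw [Finset.HasAntidiagonal.mem_antidiagonal] at hq
      rw [intervalIntegral.integral_const_mul, integral_pow_mul_sub_pow, ← hq,
        Nat.cast_add_choose ℝ]
      have e : q.1 + (n + q.2) + 1 = n + 1 + (q.1 + q.2) := by ring
      rw [e]
      have h1 : (q.1 ! : ℝ) ≠ 0 := by positivity
      have h2 : (q.2 ! : ℝ) ≠ 0 := by positivity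
      have h3 : ((n + q.2)! : ℝ) ≠ 0 := by positivity
      field_simp
    · intro s hs
      have : t - s < 0 := by
        have h1 := hs.1
        have h2 := hs.2
        simp only [Set.mem_Ioi, Set.mem_Ioc, not_and, not_le] at h1 h2
        linarith [h2 h1]
      rw [setIntegral_holdingSet_of_neg n this, mul_zero]

end

/-! ### Averaging over the directions and the moments of one direction. -/

/-- The moments `E cos^k θ` of a direction with density `f_ν`. -/
def directionMoment (ν : ℝ) (k : ℕ) : ℝ :=
  ∫ θ, Real.cos θ ^ k ∂(directionLaw ν)

/-- The generating series of the moments `E cos^k θ`. -/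
def directionSeries (ν : ℝ) : PowerSeries ℝ :=
  PowerSeries.mk (directionMoment ν)

/-- Both sides are sums over exponents `l` of products; independence matches them monomial by
monomial. -/
theorem integral_completeSymm_cos (ν : ℝ) [IsProbabilityMeasure (directionLaw ν)] (n p : ℕ) :
    ∫ y, completeSymm n p (fun j => Real.cos (y j))
        ∂(Measure.infinitePi fun _ : ℕ => directionLaw ν) =
      PowerSeries.coeff p (directionSeries ν ^ n) := by
  have hbd : ∀ (l : ℕ →₀ ℕ) (y : ℕ → ℝ),
      ‖∏ j ∈ Finset.range n, Real.cos (y j) ^ l j‖ ≤ 1 := fun l y => by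
    rw [norm_prod]
    refine Finset.prod_le_one (fun _ _ => norm_nonneg _) fun j _ => ?_
    rw [norm_pow]
    exact pow_le_one₀ (norm_nonneg _) (Real.abs_cos_le_one _)
  have hint : ∀ l : ℕ →₀ ℕ, Integrable (fun y : ℕ → ℝ => ∏ j ∈ Finset.range n, Real.cos (y j) ^ l j)
      (Measure.infinitePi fun _ : ℕ => directionLaw ν) := fun l =>
    Integrable.of_bound (Measurable.aestronglyMeasurable (by fun_prop)) 1
      (Filter.Eventually.of_forall (hbd l))
  have hpow : directionSeries ν ^ n = ∏ _j ∈ Finset.range n, directionSeries ν := by simp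
  rw [hpow, PowerSeries.coeff_prod]
  simp only [completeSymm, PowerSeries.coeff_prod, PowerSeries.coeff_mk]
  rw [integral_finsetSum _ fun l _ => hint l]
  refine Finset.sum_congr rfl fun l _ => ?_
  simp only [Finset.prod_range]
  have hind : iIndepFun (fun (i : Fin n) (y : ℕ → ℝ) => y i)
      (Measure.infinitePi fun _ : ℕ => directionLaw ν) :=
    (iIndepFun_infinitePi (P := fun _ : ℕ => directionLaw ν) (X := fun _ x => x)
      (fun _ => measurable_id)).precomp (g := fun i : Fin n => (i : ℕ)) Fin.val_injective
  rw [hind.integral_fun_prod_comp (f := fun (i : Fin n) x => Real.cos x ^ l i)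
    (fun i => (measurable_pi_apply _).aemeasurable)
    (fun i => Measurable.aestronglyMeasurable (by fun_prop))]
  refine Finset.prod_congr rfl fun i _ => ?_
  have h := integral_map (μ := Measure.infinitePi fun _ : ℕ => directionLaw ν)
    (measurable_pi_apply (i : ℕ)).aemeasurable (f := fun x => Real.cos x ^ l i)
    (Measurable.aestronglyMeasurable (by fun_prop))
  rw [Measure.infinitePi_map_eval (fun _ : ℕ => directionLaw ν) i] at h
  rw [directionSeries, PowerSeries.coeff_mk, directionMoment, h]

/-- The bound on `ν` makes both Gamma factors positive, so `ENNReal.ofReal` truncates nothing. -/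
theorem directionMoment_eq (ν : ℝ) (hν : -(1 / 2) < ν) (k : ℕ) :
    directionMoment ν k =
      ∫ θ in (0 : ℝ)..Real.pi, directionDensity ν θ * Real.cos θ ^ k := by
  rw [directionMoment, directionLaw, integral_withDensity_eq_integral_toReal_smul₀,
    intervalIntegral.integral_of_le Real.pi_pos.le, integral_Ioc_eq_integral_Ioo]
  · refine setIntegral_congr_fun measurableSet_Ioo fun θ hθ => ?_
    have h1 : 0 < Real.sin θ := Real.sin_pos_of_mem_Ioo hθ
    have h2 : 0 ≤ directionDensity ν θ := by
      have := Real.Gamma_pos_of_pos (show 0 < ν + 1 by linarith)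
      have := Real.Gamma_pos_of_pos (show 0 < ν + 1 / 2 by linarith)
      unfold directionDensity
      positivity
    simp [ENNReal.toReal_ofReal h2]
  · unfold directionDensity
    fun_prop
  · simp

theorem directionMoment_zero_eq (k : ℕ) :
    directionMoment 0 k = (1 / Real.pi) * ∫ θ in (0 : ℝ)..Real.pi, Real.cos θ ^ k := by
  rw [directionMoment_eq 0 (by norm_num), ← intervalIntegral.integral_const_mul]
  simp only [directionDensity, mul_zero, Real.rpow_zero, zero_add, Real.Gamma_one,
    Real.Gamma_one_half_eq, Real.mul_self_sqrt Real.pi_pos.le, mul_one]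

theorem directionMoment_one_eq (k : ℕ) :
    directionMoment 1 k = (2 / Real.pi) * ((∫ θ in (0 : ℝ)..Real.pi, Real.cos θ ^ k) -
      ∫ θ in (0 : ℝ)..Real.pi, Real.cos θ ^ (k + 2)) := by
  rw [directionMoment_eq 1 (by norm_num), ← intervalIntegral.integral_sub
    (Continuous.intervalIntegrable (by fun_prop) _ _)
    (Continuous.intervalIntegrable (by fun_prop) _ _), ← intervalIntegral.integral_const_mul]
  have h2 : Real.Gamma (1 + 1) = 1 := by
    rw [Real.Gamma_add_one one_ne_zero, Real.Gamma_one, one_mul]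
  have h3 : Real.Gamma (1 + 1 / 2) = √Real.pi / 2 := by
    rw [add_comm, Real.Gamma_add_one (by norm_num), Real.Gamma_one_half_eq]
    ring
  have h4 : √Real.pi * (√Real.pi / 2) = Real.pi / 2 := by
    rw [← mul_div_assoc, Real.mul_self_sqrt Real.pi_pos.le]
  refine intervalIntegral.integral_congr fun θ _ => ?_
  have h5 : Real.sin θ ^ (2 * (1 : ℝ)) = 1 - Real.cos θ ^ 2 := by
    rw [mul_one, Real.rpow_two, Real.sin_sq]
  simp only [directionDensity, h2, h3, h4, h5]
  field_simp
  ring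

theorem integral_cos_pow_zero_pi (k : ℕ) :
    ∫ θ in (0 : ℝ)..Real.pi, Real.cos θ ^ (k + 2) =
      (k + 1) / (k + 2) * ∫ θ in (0 : ℝ)..Real.pi, Real.cos θ ^ k := by
  rw [integral_cos_pow]
  simp

theorem directionMoment_zero_zero : directionMoment 0 0 = 1 := by
  rw [directionMoment_zero_eq]
  simp [Real.pi_ne_zero]

theorem directionMoment_zero_one : directionMoment 0 1 = 0 := by
  rw [directionMoment_zero_eq]
  simp

theorem directionMoment_zero_add_two (k : ℕ) :
    (k + 2) * directionMoment 0 (k + 2) = (k + 1) * directionMoment 0 k := by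
  rw [directionMoment_zero_eq, directionMoment_zero_eq, integral_cos_pow_zero_pi]
  field_simp

theorem directionMoment_one_eq' (k : ℕ) :
    directionMoment 1 k =
      (2 / Real.pi) / (k + 2) * ∫ θ in (0 : ℝ)..Real.pi, Real.cos θ ^ k := by
  rw [directionMoment_one_eq, integral_cos_pow_zero_pi]
  field_simp
  ring

theorem directionMoment_one_zero : directionMoment 1 0 = 1 := by
  rw [directionMoment_one_eq']
  simp
  field_simp

theorem directionMoment_one_one : directionMoment 1 1 = 0 := by
  rw [directionMoment_one_eq']
  simp

theorem directionMoment_one_add_two (k : ℕ) :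
    (k + 4) * directionMoment 1 (k + 2) = (k + 1) * directionMoment 1 k := by
  rw [directionMoment_one_eq', directionMoment_one_eq', integral_cos_pow_zero_pi]
  push_cast
  field_simp
  ring

/-! ### Coefficients of the powers of the two generating series. -/

open PowerSeries in
/-- The coefficients of `(1 - X²)^(-r/2)` are characterised by a two-step recursion, which is
equivalent to the differential equation `(1 - X²) f' = r X f`. -/
theorem one_sub_X_sq_mul_derivative_iff (r : ℝ) (f : PowerSeries ℝ) :
    (1 - X ^ 2) * d⁄dX ℝ f = C r * (X * f) ↔
      coeff 1 f = 0 ∧ ∀ k : ℕ, (k + 2) * coeff (k + 2) f = (k + r) * coeff k f := by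
  have h0 : coeff 0 ((1 - X ^ 2) * d⁄dX ℝ f) = coeff 1 f := by
    simp only [sub_mul, one_mul, pow_two, mul_assoc, map_sub, coeff_zero_X_mul, sub_zero,
      coeff_derivative]
    simp
  have h1 : ∀ k : ℕ, coeff (k + 1) ((1 - X ^ 2) * d⁄dX ℝ f) =
      (k + 2) * coeff (k + 2) f - k * coeff k f := fun k => by
    rw [sub_mul, one_mul, map_sub, coeff_derivative, pow_two, mul_assoc, coeff_succ_X_mul]
    cases k with
    | zero =>
      simp
      ring
    | succ k =>
      rw [coeff_succ_X_mul, coeff_derivative]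
      push_cast
      ring
  have h2 : ∀ k : ℕ, coeff (k + 1) (C r * (X * f)) = r * coeff k f := fun k => by
    rw [coeff_C_mul, coeff_succ_X_mul]
  constructor
  · intro h
    refine ⟨?_, fun k => ?_⟩
    · rw [← h0, h]
      simp
    · have := h1 k
      rw [h, h2] at this
      linear_combination -this
  · rintro ⟨ha, hb⟩
    ext k
    cases k with
    | zero =>
      rw [h0, ha]
      simp
    | succ k =>
      rw [h1, h2]
      linear_combination hb k

-- Taking the `n`-th power multiplies the logarithmic derivative `r X / (1 - X²)` by `n`.
open PowerSeries in
theorem one_sub_X_sq_mul_derivative_pow {r : ℝ} {f : PowerSeries ℝ}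
    (h : (1 - X ^ 2) * d⁄dX ℝ f = C r * (X * f)) (n : ℕ) :
    (1 - X ^ 2) * d⁄dX ℝ (f ^ n) = C (n * r) * (X * f ^ n) := by
  rw [derivative_pow]
  cases n with
  | zero => simp
  | succ n =>
    rw [Nat.add_sub_cancel, map_mul, map_natCast]
    linear_combination ((n + 1 : ℕ) : PowerSeries ℝ) * f ^ n * h

-- The Wallis recursion of the moments is the case `r = 1`, that is, the series is `(1 -
-- X²)^(-1/2)`.
open PowerSeries in
theorem coeff_directionSeries_zero_pow (n : ℕ) :
    coeff 1 (directionSeries 0 ^ n) = 0 ∧ ∀ k : ℕ,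
      (k + 2) * coeff (k + 2) (directionSeries 0 ^ n) =
        (k + n) * coeff k (directionSeries 0 ^ n) := by
  have h : (1 - X ^ 2) * d⁄dX ℝ (directionSeries 0) = C 1 * (X * directionSeries 0) := by
    rw [one_sub_X_sq_mul_derivative_iff]
    simp only [directionSeries, coeff_mk]
    exact ⟨directionMoment_zero_one, directionMoment_zero_add_two⟩
  have := one_sub_X_sq_mul_derivative_pow h n
  rwa [one_sub_X_sq_mul_derivative_iff, mul_one] at this

theorem constantCoeff_directionSeries_zero_pow (n : ℕ) :
    PowerSeries.coeff 0 (directionSeries 0 ^ n) = 1 := by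
  rw [PowerSeries.coeff_zero_eq_constantCoeff_apply, map_pow,
    ← PowerSeries.coeff_zero_eq_constantCoeff_apply, directionSeries, PowerSeries.coeff_mk,
    directionMoment_zero_zero, one_pow]

theorem coeff_directionSeries_zero_pow_of_odd (n k : ℕ) :
    PowerSeries.coeff (2 * k + 1) (directionSeries 0 ^ n) = 0 := by
  induction k with
  | zero => exact (coeff_directionSeries_zero_pow n).1
  | succ k ih =>
    have h := (coeff_directionSeries_zero_pow n).2 (2 * k + 1)
    rw [ih, mul_zero] at h
    exact (mul_eq_zero.1 h).resolve_left (by positivity)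

theorem coeff_directionSeries_zero_pow_of_even (n k : ℕ) :
    ((2 * k)! / (n + 2 * k)! : ℝ) *
      PowerSeries.coeff (2 * k) (directionSeries 0 ^ (n + 1)) =
      Real.Gamma (k + 1 / 2) / (2 ^ n * Real.Gamma ((n + 1) / 2) * Real.Gamma (n / 2 + k + 1)) := by
  have hg : Real.Gamma (((n : ℝ) + 1) / 2) ≠ 0 := (Real.Gamma_pos_of_pos (by positivity)).ne'
  induction k with
  | zero =>
    -- Duplication at `(n + 1) / 2` rewrites `1 / n!` by two Gamma values, as the Bessel and Struve
    -- series require.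
    have h := Real.Gamma_mul_Gamma_add_half (((n : ℝ) + 1) / 2)
    have e1 : ((n : ℝ) + 1) / 2 + 1 / 2 = n / 2 + 1 := by ring
    have e2 : 2 * (((n : ℝ) + 1) / 2) = n + 1 := by ring
    have e3 : (1 : ℝ) - (n + 1) = -n := by ring
    rw [e1, e2, e3, Real.rpow_neg zero_le_two, Real.rpow_natCast, Real.Gamma_nat_eq_factorial] at h
    have hg2 : Real.Gamma ((n : ℝ) / 2 + 1) ≠ 0 := (Real.Gamma_pos_of_pos (by positivity)).ne'
    have hn : (n ! : ℝ) ≠ 0 := by positivity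
    simp only [mul_zero, add_zero, constantCoeff_directionSeries_zero_pow, Nat.cast_zero, zero_add,
      Real.Gamma_one_half_eq, Nat.factorial_zero, Nat.cast_one, mul_one]
    rw [mul_assoc, h]
    field_simp
  | succ k ih =>
    have h := (coeff_directionSeries_zero_pow (n + 1)).2 (2 * k)
    have e1 : 2 * (k + 1) = 2 * k + 2 := by ring
    have e2 : n + (2 * k + 2) = n + 2 * k + 1 + 1 := by ring
    have e3 : ((k + 1 : ℕ) : ℝ) + 1 / 2 = (k + 1 / 2) + 1 := by push_cast; ring
    have e4 : (n : ℝ) / 2 + (k + 1 : ℕ) + 1 = (n / 2 + k + 1) + 1 := by push_cast; ring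
    have hg3 : Real.Gamma ((n : ℝ) / 2 + k + 1) ≠ 0 := (Real.Gamma_pos_of_pos (by positivity)).ne'
    have hk : ((n + 2 * k)! : ℝ) ≠ 0 := by positivity
    rw [e1, e2, e3, e4, Real.Gamma_add_one (by positivity), Real.Gamma_add_one (by positivity),
      Nat.factorial_succ (n + 2 * k + 1), Nat.factorial_succ (n + 2 * k),
      Nat.factorial_succ (2 * k + 1), Nat.factorial_succ (2 * k)]
    push_cast at h ⊢
    have h' : PowerSeries.coeff (2 * k + 2) (directionSeries 0 ^ (n + 1)) =
        (2 * k + (n + 1)) / (2 * k + 2) * PowerSeries.coeff (2 * k) (directionSeries 0 ^ (n + 1)) := by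
      field_simp
      linear_combination h
    have h'' : PowerSeries.coeff (2 * k) (directionSeries 0 ^ (n + 1)) =
        Real.Gamma (k + 1 / 2) / (2 ^ n * Real.Gamma ((n + 1) / 2) * Real.Gamma (n / 2 + k + 1)) *
          ((n + 2 * k)! / (2 * k)!) := by
      rw [← ih]
      field_simp
    rw [h', h'']
    field_simp
    ring

-- The moment recursion says that `T = 1 - X² M / 2` is `(1 - X²)^(1/2)`. Expanding `T² = 1 - X²`
-- and cancelling `X²` gives the quadratic equation.
open PowerSeries in
theorem directionSeries_one_eq :
    directionSeries 1 = 1 + C (1 / 4) * X ^ 2 * directionSeries 1 ^ 2 := by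
  obtain ⟨T, hT⟩ : ∃ T, T = 1 - C (1 / 2) * (X * (X * directionSeries 1)) := ⟨_, rfl⟩
  have hc : ∀ k, coeff (k + 2) T = -(1 / 2) * directionMoment 1 k := fun k => by
    rw [hT, map_sub, coeff_C_mul, coeff_succ_X_mul, coeff_succ_X_mul, directionSeries, coeff_mk,
      coeff_one]
    simp
  have hc0 : coeff 0 T = 1 := by simp [hT]
  have hc1 : coeff 1 T = 0 := by
    rw [hT, map_sub, coeff_C_mul, coeff_succ_X_mul, coeff_one]
    simp
  have hode : (1 - X ^ 2) * d⁄dX ℝ T = C (-1) * (X * T) := by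
    rw [one_sub_X_sq_mul_derivative_iff]
    refine ⟨hc1, fun k => ?_⟩
    rcases k with _ | _ | k
    · rw [hc, hc0, directionMoment_one_zero]
      norm_num
    · rw [hc, zero_add, hc1, directionMoment_one_one]
      norm_num
    · rw [hc, hc]
      push_cast
      linear_combination -(1 / 2) * directionMoment_one_add_two k
  have hode2 := one_sub_X_sq_mul_derivative_pow hode 2
  rw [one_sub_X_sq_mul_derivative_iff] at hode2
  obtain ⟨hs1, hs⟩ := hode2
  have hs0 : coeff 0 (T ^ 2) = 1 := by
    rw [coeff_zero_eq_constantCoeff_apply, map_pow, ← coeff_zero_eq_constantCoeff_apply, hc0,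
      one_pow]
  have hs2 : coeff 2 (T ^ 2) = -1 := by
    have := hs 0
    rw [hs0] at this
    norm_num at this
    linarith
  have hs3 : ∀ k, coeff (k + 3) (T ^ 2) = 0 := by
    intro k
    induction k using Nat.twoStepInduction with
    | zero =>
      have := hs 1
      rw [hs1] at this
      norm_num at this
      exact this
    | one =>
      -- The factor `k + r` with `r = -2` vanishes here, so the recursion stops.
      have := hs 2
      rw [hs2] at this
      norm_num at this
      exact this
    | more k ih _ =>
      have := hs (k + 3)
      rw [ih, mul_zero] at this
      exact (mul_eq_zero.1 this).resolve_left (by positivity)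
  have hsq : T ^ 2 = 1 - X ^ 2 := by
    ext k
    rcases k with _ | _ | _ | k
    · rw [hs0]; simp
    · rw [hs1]; simp [coeff_one, coeff_X_pow]
    · rw [hs2]; simp [coeff_one, coeff_X_pow]
    · rw [hs3]; simp [coeff_one, coeff_X_pow]
  have hX : (X : PowerSeries ℝ) ^ 2 ≠ 0 := pow_ne_zero _ X_ne_zero
  refine mul_left_cancel₀ hX ?_
  have hC : (C (1 / 4 : ℝ) : PowerSeries ℝ) = C (1 / 2) * C (1 / 2) := by
    rw [← map_mul]
    norm_num
  have hC2 : (2 : PowerSeries ℝ) * C (1 / 2 : ℝ) = 1 := by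
    have : (2 : PowerSeries ℝ) = C (2 : ℝ) := (map_ofNat C 2).symm
    rw [this, ← map_mul]
    norm_num
  rw [hT] at hsq
  rw [hC]
  linear_combination -hsq - X ^ 2 * directionSeries 1 * hC2

-- The quadratic equation times `M^n`: it expresses a power of `M` by the two preceding ones, at a
-- shifted degree.
open PowerSeries in
theorem coeff_directionSeries_one_pow_add_two (n p : ℕ) :
    coeff p (directionSeries 1 ^ (n + 2)) =
      4 * (coeff (p + 2) (directionSeries 1 ^ (n + 1)) - coeff (p + 2) (directionSeries 1 ^ n)) := by
  have h : directionSeries 1 ^ (n + 1) - directionSeries 1 ^ n =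
      C (1 / 4) * (X * (X * directionSeries 1 ^ (n + 2))) := by
    linear_combination directionSeries 1 ^ n * directionSeries_one_eq
  rw [← map_sub, h, coeff_C_mul, coeff_succ_X_mul, coeff_succ_X_mul]
  ring

theorem coeff_directionSeries_one_pow_of_odd (n k : ℕ) :
    PowerSeries.coeff (2 * k + 1) (directionSeries 1 ^ n) = 0 := by
  induction n using Nat.twoStepInduction generalizing k with
  | zero => simp [PowerSeries.coeff_one]
  | one =>
    rw [pow_one, directionSeries, PowerSeries.coeff_mk]
    induction k with
    | zero => exact directionMoment_one_one
    | succ k ih =>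
      have h := directionMoment_one_add_two (2 * k + 1)
      rw [ih, mul_zero] at h
      exact (mul_eq_zero.1 h).resolve_left (by positivity)
  | more n ih₁ ih₂ =>
    have e : 2 * k + 1 + 2 = 2 * (k + 1) + 1 := by ring
    rw [coeff_directionSeries_one_pow_add_two, e, ih₁, ih₂]
    simp

/-- The `k`-th Catalan number divided by `4 ^ k`. -/
theorem directionMoment_one_of_even (k : ℕ) :
    directionMoment 1 (2 * k) = (2 * k)! / (4 ^ k * k ! * (k + 1)!) := by
  induction k with
  | zero => simp [directionMoment_one_zero]
  | succ k ih =>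
    have h := directionMoment_one_add_two (2 * k)
    rw [ih] at h
    have h' : directionMoment 1 (2 * (k + 1)) = (2 * k + 1) / (2 * k + 4) *
        ((2 * k)! / (4 ^ k * k ! * (k + 1)!)) := by
      push_cast at h
      have e : 2 * (k + 1) = 2 * k + 2 := by ring
      rw [e, div_mul_eq_mul_div, eq_div_iff (by positivity)]
      linear_combination h
    have e1 : 2 * (k + 1) = 2 * k + 1 + 1 := by ring
    rw [h', e1, Nat.factorial_succ (2 * k + 1), Nat.factorial_succ (2 * k),
      Nat.factorial_succ (k + 1), Nat.factorial_succ k]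
    push_cast
    have : (k ! : ℝ) ≠ 0 := by positivity
    field_simp
    ring

theorem coeff_directionSeries_one_pow_of_even (n k : ℕ) :
    PowerSeries.coeff (2 * k) (directionSeries 1 ^ (n + 1)) =
      (n + 1) * (n + 2 * k)! / (4 ^ k * k ! * (n + k + 1)!) := by
  induction n using Nat.twoStepInduction generalizing k with
  | zero =>
    rw [zero_add, pow_one, directionSeries, PowerSeries.coeff_mk, directionMoment_one_of_even]
    simp
  | one =>
    have h := coeff_directionSeries_one_pow_add_two 0 (2 * k)
    have e : 2 * k + 2 = 2 * (k + 1) := by ring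
    rw [zero_add, pow_one, pow_zero, PowerSeries.coeff_one, if_neg (by omega), e, directionSeries,
      PowerSeries.coeff_mk, directionMoment_one_of_even, ← directionSeries] at h
    have e1 : 2 * (k + 1) = 1 + 2 * k + 1 := by ring
    have e2 : 1 + k + 1 = k + 1 + 1 := by ring
    rw [h, e1, e2, Nat.factorial_succ (1 + 2 * k), Nat.factorial_succ (k + 1), Nat.factorial_succ k]
    push_cast
    have : (k ! : ℝ) ≠ 0 := by positivity
    field_simp
    ring
  | more n ih₁ ih₂ =>
    have h := coeff_directionSeries_one_pow_add_two (n + 1) (2 * k)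
    have e : 2 * k + 2 = 2 * (k + 1) := by ring
    rw [e, ih₁, ih₂] at h
    have e1 : n + 1 + 2 * (k + 1) = n + 2 + 2 * k + 1 := by ring
    have e2 : n + 2 * (k + 1) = n + 2 + 2 * k := by ring
    have e3 : n + 1 + (k + 1) + 1 = n + k + 1 + 1 + 1 := by ring
    have e4 : n + (k + 1) + 1 = n + k + 1 + 1 := by ring
    have e5 : n + 2 + k + 1 = n + k + 1 + 1 + 1 := by ring
    rw [show n + 2 + 1 = n + 1 + 2 by ring, h, e1, e2, e3, e4, e5,
      Nat.factorial_succ (n + 2 + 2 * k), Nat.factorial_succ (n + k + 1 + 1), Nat.factorial_succ k]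
    push_cast
    have : (k ! : ℝ) ≠ 0 := by positivity
    have : ((n + k + 1 + 1)! : ℝ) ≠ 0 := by positivity
    field_simp
    ring

theorem Gamma_nat_add_half_eq (k : ℕ) :
    Real.Gamma (k + 1 / 2) = (2 * k)! / (4 ^ k * k !) * √Real.pi := by
  induction k with
  | zero => simp [← Real.Gamma_one_half_eq]
  | succ k ih =>
    have e3 : ((k + 1 : ℕ) : ℝ) + 1 / 2 = (k + 1 / 2) + 1 := by push_cast; ring
    have e1 : 2 * (k + 1) = 2 * k + 1 + 1 := by ring
    rw [e3, Real.Gamma_add_one (by positivity), ih, e1, Nat.factorial_succ (2 * k + 1),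
      Nat.factorial_succ (2 * k), Nat.factorial_succ k]
    push_cast
    have : (k ! : ℝ) ≠ 0 := by positivity
    field_simp
    ring

/-! ### From the motion to the product measure. -/

theorem eventCount_eq {Ω : Type*} {τ : ℕ → Ω → ℝ} {t : ℝ} {n : ℕ} {ω : Ω} (h0 : ∀ i, 0 ≤ τ i ω)
    (hm : (fun i => τ i ω) ∈ holdingSet n t) : eventCount τ t ω = n := by
  have hmono : Monotone fun k => eventTime τ k ω :=
    monotone_nat_of_le_succ fun k => by
      simp only [eventTime, Finset.sum_range_succ]
      linarith [h0 k]
  have hset : {k : ℕ | 1 ≤ k ∧ eventTime τ k ω ≤ t} = Finset.Icc 1 n := by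
    ext k
    simp only [Set.mem_ofPred_eq, Finset.coe_Icc, Set.mem_Icc, and_congr_right_iff]
    intro _
    constructor
    · intro hk
      by_contra hlt
      have h1 : eventTime τ (n + 1) ω ≤ eventTime τ k ω := hmono (by omega)
      exact absurd (h1.trans hk) (not_le.2 hm.2)
    · intro hk
      exact (hmono hk).trans hm.1
  rw [eventCount, hset, Set.ncard_coe_finset]
  simp

theorem position_eq {Ω : Type*} (c : ℝ) {τ θ : ℕ → Ω → ℝ} {t : ℝ} {n : ℕ} {ω : Ω}
    (h0 : ∀ i, 0 ≤ τ i ω) (hm : (fun i => τ i ω) ∈ holdingSet n t) :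
    position c τ θ t ω =
      c * displacement n t (fun j => Real.cos (θ j ω)) (fun i => τ i ω) := by
  have hN := eventCount_eq h0 hm
  rw [position, hN, Finset.sum_range_succ, displacement]
  congr 2
  · refine Finset.sum_congr rfl fun j hj => ?_
    rw [Finset.mem_range] at hj
    rw [switchTime, switchTime, hN, if_pos (by omega), if_pos (by omega), eventTime, eventTime,
      Finset.sum_range_succ]
    ring
  -- The last piece ends at index `n + 1`, beyond the count, where `switchTime` is `t`.
  · rw [switchTime, switchTime, hN, if_neg (by omega), if_pos le_rfl, eventTime]

/-- Almost surely only finitely many events occur: the moment formula with `p = 0` gives the Poisson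
weights, which sum to `1`. -/
theorem ae_exists_mem_holdingSet {lam t : ℝ} [IsProbabilityMeasure (expMeasure lam)]
    (hlam : 0 < lam) (ht : 0 ≤ t) :
    ∀ᵐ x ∂(Measure.infinitePi fun _ : ℕ => expMeasure lam), x ∈ ⋃ n, holdingSet n t := by
  have hd : Pairwise (Function.onFun
      (AEDisjoint (Measure.infinitePi fun _ : ℕ => expMeasure lam))
      fun n => holdingSet n t) := by
    intro m n hmn
    rw [Function.onFun, AEDisjoint, measure_eq_zero_iff_ae_notMem]
    filter_upwards [ae_nonneg_infinitePi_expMeasure] with x hx hmem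
    exact hmn ((eventCount_eq (τ := fun i (x : ℕ → ℝ) => x i) hx hmem.1).symm.trans
      (eventCount_eq (τ := fun i (x : ℕ → ℝ) => x i) hx hmem.2))
  have hs := hasSum_integral_iUnion_ae (f := fun _ => (1 : ℝ))
    (fun n => (measurableSet_holdingSet n t).nullMeasurableSet) hd (integrable_const _)
  have h1 : ∀ n, ∫ _ in holdingSet n t, (1 : ℝ)
      ∂(Measure.infinitePi fun _ : ℕ => expMeasure lam) =
      Real.exp (-(lam * t)) * ((lam * t) ^ n / n !) := fun n => by
    have h := setIntegral_displacement_pow hlam n 0 ht (a := fun _ => 0) (by simp)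
    have hc : completeSymm (n + 1) 0 (fun _ => 0) = 1 := by simp [completeSymm]
    simp only [pow_zero] at h
    rw [h, hc, mul_pow]
    simp
    ring
  have h2 : HasSum (fun n : ℕ => Real.exp (-(lam * t)) * ((lam * t) ^ n / n !)) 1 := by
    have h := (NormedSpace.expSeries_div_hasSum_exp (lam * t)).mul_left (Real.exp (-(lam * t)))
    rwa [← Real.exp_eq_exp_ℝ, ← Real.exp_add, neg_add_cancel, Real.exp_zero] at h
  simp only [h1] at hs
  have h3 := hs.unique h2
  simp only [integral_const, smul_eq_mul, mul_one, measureReal_restrict_apply_univ] at h3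
  rw [measureReal_def, ENNReal.toReal_eq_one_iff] at h3
  exact (mem_ae_iff_prob_eq_one₀
    (MeasurableSet.iUnion fun n => measurableSet_holdingSet n t).nullMeasurableSet).2 h3

section

variable {Ω : Type*} [MeasurableSpace Ω] {P : Measure Ω} [IsProbabilityMeasure P]
  {ν c lam t : ℝ} {τ θ : ℕ → Ω → ℝ}

theorem map_waitingTimes_directions [IsProbabilityMeasure (expMeasure lam)]
    [IsProbabilityMeasure (directionLaw ν)] (hτ : ArePoissonWaitingTimes lam τ P)
    (hθ : AreDirections ν θ P) (hind : IndepFun (fun ω i => τ i ω) (fun ω j => θ j ω) P) :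
    P.map (fun ω => ((fun i => τ i ω), fun j => θ j ω)) =
      (Measure.infinitePi fun _ : ℕ => expMeasure lam).prod
        (Measure.infinitePi fun _ : ℕ => directionLaw ν) := by
  have h1 := hτ.indep.map_fun_eq_infinitePi_map hτ.measurable
  have h2 := hθ.indep.map_fun_eq_infinitePi_map hθ.measurable
  simp only [hτ.law, hθ.law] at h1 h2
  rw [hind.map_prod_eq_prod_map_map (measurable_pi_lambda _ hτ.measurable).aemeasurable
    (measurable_pi_lambda _ hθ.measurable).aemeasurable, h1, h2]

/-- Fubini, integrating the waiting times first with the directions frozen. -/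
theorem setIntegral_position_pow (hlam : 0 < lam) (ht : 0 ≤ t)
    [IsProbabilityMeasure (expMeasure lam)]
    [IsProbabilityMeasure (directionLaw ν)] (hτ : ArePoissonWaitingTimes lam τ P)
    (hθ : AreDirections ν θ P) (hind : IndepFun (fun ω i => τ i ω) (fun ω j => θ j ω) P)
    (n p : ℕ) :
    ∫ ω in {ω | (fun i => τ i ω) ∈ holdingSet n t},
        (c * displacement n t (fun j => Real.cos (θ j ω)) (fun i => τ i ω)) ^ p ∂P =
      Real.exp (-(lam * t)) * (c * t) ^ p * ((lam * t) ^ n *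
        ((p ! / (n + p)! : ℝ) * PowerSeries.coeff p (directionSeries ν ^ (n + 1)))) := by
  have hτm : Measurable fun ω i => τ i ω := measurable_pi_lambda _ hτ.measurable
  have hθm : Measurable fun ω j => θ j ω := measurable_pi_lambda _ hθ.measurable
  have hdm : Measurable fun q : (ℕ → ℝ) × (ℕ → ℝ) =>
      displacement n t (fun j => Real.cos (q.2 j)) q.1 ^ p := by
    unfold displacement
    fun_prop
  have hS : MeasurableSet {q : (ℕ → ℝ) × (ℕ → ℝ) | q.1 ∈ holdingSet n t} :=
    measurable_fst (measurableSet_holdingSet n t)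
  have hS' : MeasurableSet {ω | (fun i => τ i ω) ∈ holdingSet n t} :=
    hτm (measurableSet_holdingSet n t)
  set F : (ℕ → ℝ) × (ℕ → ℝ) → ℝ := Set.indicator {q | q.1 ∈ holdingSet n t}
    fun q => displacement n t (fun j => Real.cos (q.2 j)) q.1 ^ p with hF
  have hFm : Measurable F := hdm.indicator hS
  have hFi : Integrable F ((Measure.infinitePi fun _ : ℕ => expMeasure lam).prod
      (Measure.infinitePi fun _ : ℕ => directionLaw ν)) := by
    refine Integrable.of_bound hFm.aestronglyMeasurable (t ^ p) ?_
    have h0 := (Measure.quasiMeasurePreserving_fst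
      (μ := Measure.infinitePi fun _ : ℕ => expMeasure lam)
      (ν := Measure.infinitePi fun _ : ℕ => directionLaw ν)).ae
        (ae_nonneg_infinitePi_expMeasure (lam := lam))
    filter_upwards [h0] with q hq
    by_cases h : q ∈ {q : (ℕ → ℝ) × (ℕ → ℝ) | q.1 ∈ holdingSet n t}
    · rw [hF, Set.indicator_of_mem h, norm_pow]
      exact pow_le_pow_left₀ (norm_nonneg _)
        (abs_displacement_le (fun j => Real.abs_cos_le_one _) hq h) p
    · rw [hF, Set.indicator_of_notMem h, norm_zero]
      positivity
  have hmain : ∫ ω in {ω | (fun i => τ i ω) ∈ holdingSet n t},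
      displacement n t (fun j => Real.cos (θ j ω)) (fun i => τ i ω) ^ p ∂P =
      ∫ q, F q ∂((Measure.infinitePi fun _ : ℕ => expMeasure lam).prod
        (Measure.infinitePi fun _ : ℕ => directionLaw ν)) := by
    rw [← map_waitingTimes_directions hτ hθ hind,
      integral_map (hτm.prodMk hθm).aemeasurable hFm.aestronglyMeasurable,
      ← integral_indicator hS']
    rfl
  have hinner : ∀ y : ℕ → ℝ, ∫ x, F (x, y) ∂(Measure.infinitePi fun _ : ℕ => expMeasure lam) =
      lam ^ n * Real.exp (-(lam * t)) * t ^ (n + p) * (p ! / (n + p)!) *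
        completeSymm (n + 1) p (fun j => Real.cos (y j)) := fun y => by
    rw [← setIntegral_displacement_pow hlam n p ht (fun j => Real.abs_cos_le_one _),
      ← integral_indicator (measurableSet_holdingSet n t)]
    rfl
  simp only [mul_pow c]
  rw [integral_const_mul, hmain, integral_prod_symm F hFi]
  simp only [hinner]
  rw [integral_const_mul, integral_completeSymm_cos]
  ring

theorem IsMotion.integrable_and_hasSum {X : ℝ → Ω → ℝ} (hX : IsMotion ν c lam X P) (hc : 0 ≤ c)
    (hlam : 0 < lam) (ht : 0 < t) (p : ℕ) :
    Integrable (fun ω => X t ω ^ p) P ∧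
    HasSum (fun n : ℕ => Real.exp (-(lam * t)) * (c * t) ^ p * ((lam * t) ^ n *
        ((p ! / (n + p)! : ℝ) * PowerSeries.coeff p (directionSeries ν ^ (n + 1)))))
      (∫ ω, X t ω ^ p ∂P) := by
  obtain ⟨τ, θ, hτ, hθ, hind, hXeq⟩ := hX
  have := isProbabilityMeasure_expMeasure hlam
  -- Being the law of `θ 0`, the measure needs no computation of its normalising constant.
  have : IsProbabilityMeasure (directionLaw ν) := by
    rw [← hθ.law 0]
    exact Measure.isProbabilityMeasure_map (hθ.measurable 0).aemeasurable
  have hτm : Measurable fun ω i => τ i ω := measurable_pi_lambda _ hτ.measurable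
  have hτlaw := hτ.indep.map_fun_eq_infinitePi_map hτ.measurable
  simp only [hτ.law] at hτlaw
  have hnonneg : ∀ᵐ ω ∂P, ∀ i, 0 ≤ τ i ω := by
    have h := ae_nonneg_infinitePi_expMeasure (lam := lam)
    rw [← hτlaw] at h
    exact ae_of_ae_map hτm.aemeasurable h
  have hcover : ∀ᵐ ω ∂P, ω ∈ ⋃ n, {ω | (fun i => τ i ω) ∈ holdingSet n t} := by
    have h := ae_exists_mem_holdingSet hlam ht.le
    rw [← hτlaw] at h
    filter_upwards [ae_of_ae_map hτm.aemeasurable h] with ω hω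
    simpa using hω
  have hS : ∀ n, MeasurableSet {ω | (fun i => τ i ω) ∈ holdingSet n t} := fun n =>
    hτm (measurableSet_holdingSet n t)
  have hd : Pairwise (Function.onFun (AEDisjoint P)
      fun n => {ω | (fun i => τ i ω) ∈ holdingSet n t}) := by
    intro m n hmn
    rw [Function.onFun, AEDisjoint, measure_eq_zero_iff_ae_notMem]
    filter_upwards [hnonneg] with ω hω hmem
    exact hmn ((eventCount_eq hω hmem.1).symm.trans (eventCount_eq hω hmem.2))
  have hpos : ∀ n, ∀ᵐ ω ∂(P.restrict {ω | (fun i => τ i ω) ∈ holdingSet n t}),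
      X t ω ^ p =
        (c * displacement n t (fun j => Real.cos (θ j ω)) (fun i => τ i ω)) ^ p := fun n => by
    rw [ae_restrict_iff' (hS n)]
    filter_upwards [hnonneg] with ω hω hmem
    rw [hXeq t ht, position_eq c hω hmem]
  have hrestrict : P.restrict (⋃ n, {ω | (fun i => τ i ω) ∈ holdingSet n t}) = P :=
    Measure.restrict_eq_self_of_ae_mem hcover
  -- Measurability is read off the explicit formula on each of the countably many pieces.
  have hmeas : AEStronglyMeasurable (fun ω => X t ω ^ p) P := by
    rw [← hrestrict, aestronglyMeasurable_iUnion_iff]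
    intro n
    refine AEStronglyMeasurable.congr ?_ (Filter.EventuallyEq.symm (hpos n))
    refine Measurable.aestronglyMeasurable ?_
    have h1 := hτ.measurable
    have h2 := hθ.measurable
    unfold displacement
    fun_prop
  have hint : Integrable (fun ω => X t ω ^ p) P := by
    refine Integrable.of_bound hmeas ((c * t) ^ p) ?_
    filter_upwards [hnonneg, hcover] with ω hω hmem
    obtain ⟨n, hn⟩ := Set.mem_iUnion.1 hmem
    rw [hXeq t ht, position_eq c hω hn, norm_pow, norm_mul, Real.norm_of_nonneg hc]
    exact pow_le_pow_left₀ (by positivity) (mul_le_mul_of_nonneg_left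
      (abs_displacement_le (fun j => Real.abs_cos_le_one _) hω hn) hc) p
  refine ⟨hint, ?_⟩
  have hsum := hasSum_integral_iUnion_ae (fun n => (hS n).nullMeasurableSet) hd
    (hint.integrableOn (s := ⋃ n, {ω | (fun i => τ i ω) ∈ holdingSet n t}))
  rw [hrestrict] at hsum
  refine hsum.congr_fun fun n => ?_
  rw [integral_congr_ae (hpos n), setIntegral_position_pow hlam ht.le hτ hθ hind]

end

/-! ### Summation over the number of events. -/

theorem hasSum_mittagLeffler_one_nat {x : ℝ} (hx : 0 ≤ x) (j : ℕ) :
    HasSum (fun n : ℕ => x ^ n / (n + j)!) (mittagLeffler 1 (j + 1) x) := by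
  have hs : Summable fun n : ℕ => x ^ n / (n + j)! := by
    refine Summable.of_nonneg_of_le (fun n => by positivity) (fun n => ?_)
      (Real.summable_pow_div_factorial x)
    gcongr
    omega
  have he : mittagLeffler 1 (j + 1) x = ∑' n : ℕ, x ^ n / (n + j)! := by
    rw [mittagLeffler]
    congr 1
    ext n
    rw [one_mul, ← add_assoc, ← Nat.cast_add, Real.Gamma_nat_eq_factorial]
  rw [he]
  exact hs.hasSum

/-- After cancellation the `n`-th term is proportional to `(n + 1) / (n + k + 1)!`; writing `n + 1 =
(n + k + 1) - k` splits the series in two. -/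
theorem hasSum_directionSeries_one {x : ℝ} (hx : 0 ≤ x) (k : ℕ) :
    HasSum (fun n : ℕ => x ^ n * (((2 * k)! / (n + 2 * k)! : ℝ) *
        PowerSeries.coeff (2 * k) (directionSeries 1 ^ (n + 1))))
      (Real.Gamma (k + 1 / 2) / √Real.pi *
        (mittagLeffler 1 (k + 1) x - k * mittagLeffler 1 (k + 2) x)) := by
  have h1 := hasSum_mittagLeffler_one_nat hx k
  have h2 := hasSum_mittagLeffler_one_nat hx (k + 1)
  have e : ((k + 1 : ℕ) : ℝ) + 1 = k + 2 := by push_cast; ring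
  rw [e] at h2
  refine ((h1.sub (h2.mul_left (k : ℝ))).mul_left
    (Real.Gamma (k + 1 / 2) / √Real.pi)).congr_fun fun n => ?_
  rw [coeff_directionSeries_one_pow_of_even, Gamma_nat_add_half_eq, ← add_assoc,
    Nat.factorial_succ (n + k)]
  have hpi : √Real.pi ≠ 0 := by positivity
  have hn : ((n + k)! : ℝ) ≠ 0 := by positivity
  have hn' : ((n + 2 * k)! : ℝ) ≠ 0 := by positivity
  push_cast
  field_simp
  ring

theorem modifiedBesselI_eq {x : ℝ} (hx : 0 < x) (k : ℕ) :
    modifiedBesselI (k + 1 / 2) x = (x / 2) ^ ((k : ℝ) - 1 / 2) *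
      ∑' m : ℕ, (x / 2) ^ (2 * m + 1) /
        (Real.Gamma (((2 * m + 1 : ℕ) + 1) / 2) * Real.Gamma ((2 * m + 1 : ℕ) / 2 + k + 1)) := by
  rw [modifiedBesselI, ← tsum_mul_left]
  congr 1
  ext m
  have e1 : 2 * (m : ℝ) + (k + 1 / 2) = (k - 1 / 2) + (2 * m + 1 : ℕ) := by push_cast; ring
  have e2 : (((2 * m + 1 : ℕ) : ℝ) + 1) / 2 = m + 1 := by push_cast; ring
  have e3 : ((2 * m + 1 : ℕ) : ℝ) / 2 + k + 1 = m + (k + 1 / 2) + 1 := by push_cast; ring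
  rw [e1, e2, e3, Real.rpow_add (by positivity), Real.rpow_natCast, mul_div_assoc]

theorem modifiedStruveL_eq {x : ℝ} (hx : 0 < x) (k : ℕ) :
    modifiedStruveL (k + 1 / 2) x = (x / 2) ^ ((k : ℝ) - 1 / 2) *
      ∑' m : ℕ, (x / 2) ^ (2 * m + 1 + 1) /
        (Real.Gamma (((2 * m + 1 + 1 : ℕ) + 1) / 2) *
          Real.Gamma ((2 * m + 1 + 1 : ℕ) / 2 + k + 1)) := by
  rw [modifiedStruveL, ← tsum_mul_left]
  congr 1
  ext m
  have e1 : 2 * (m : ℝ) + (k + 1 / 2) + 1 = (k - 1 / 2) + (2 * m + 1 + 1 : ℕ) := by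
    push_cast; ring
  have e2 : (((2 * m + 1 + 1 : ℕ) : ℝ) + 1) / 2 = m + 3 / 2 := by push_cast; ring
  have e3 : ((2 * m + 1 + 1 : ℕ) : ℝ) / 2 + k + 1 = m + (k + 1 / 2) + 3 / 2 := by push_cast; ring
  rw [e1, e2, e3, Real.rpow_add (by positivity), Real.rpow_natCast, mul_div_assoc]

/-- Up to a constant the terms form a single sequence `b n`, split into `n = 0`, odd `n` and even `n
≥ 2`. -/
theorem hasSum_directionSeries_zero {x : ℝ} (hx : 0 < x) (k : ℕ)
    (hs : Summable fun n : ℕ => x ^ n * (((2 * k)! / (n + 2 * k)! : ℝ) *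
      PowerSeries.coeff (2 * k) (directionSeries 0 ^ (n + 1)))) :
    HasSum (fun n : ℕ => x ^ n * (((2 * k)! / (n + 2 * k)! : ℝ) *
        PowerSeries.coeff (2 * k) (directionSeries 0 ^ (n + 1))))
      (Real.Gamma (k + 1 / 2) * ((2 / x) ^ ((k : ℝ) - 1 / 2) *
        (modifiedBesselI (k + 1 / 2) x + modifiedStruveL (k + 1 / 2) x) +
        1 / (√Real.pi * Real.Gamma (k + 1)))) := by
  have hg : Real.Gamma ((k : ℝ) + 1 / 2) ≠ 0 := (Real.Gamma_pos_of_pos (by positivity)).ne'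
  obtain ⟨b, hb⟩ : ∃ b : ℕ → ℝ, b = fun n : ℕ => (x / 2) ^ n /
    (Real.Gamma ((n + 1) / 2) * Real.Gamma (n / 2 + k + 1)) := ⟨_, rfl⟩
  have heq : (fun n : ℕ => x ^ n * (((2 * k)! / (n + 2 * k)! : ℝ) *
        PowerSeries.coeff (2 * k) (directionSeries 0 ^ (n + 1)))) =
      fun n => Real.Gamma (k + 1 / 2) * b n := by
    ext n
    rw [coeff_directionSeries_zero_pow_of_even, hb]
    simp only [div_pow]
    have h1 : Real.Gamma (((n : ℝ) + 1) / 2) ≠ 0 := (Real.Gamma_pos_of_pos (by positivity)).ne'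
    have h2 : Real.Gamma ((n : ℝ) / 2 + k + 1) ≠ 0 := (Real.Gamma_pos_of_pos (by positivity)).ne'
    field_simp
  rw [heq] at hs ⊢
  have hbs : Summable b := (summable_mul_left_iff hg).1 hs
  have hodd : Summable fun m => b (2 * m + 1) :=
    hbs.comp_injective fun i j h => by simpa using h
  have heven : Summable fun m => b (2 * m + 1 + 1) :=
    hbs.comp_injective fun i j h => by simpa using h
  have htsum : ∑' n, b n = b 0 + (∑' m, b (2 * m + 1) + ∑' m, b (2 * m + 1 + 1)) := by
    rw [hbs.tsum_eq_zero_add, ← tsum_even_add_odd (f := fun n => b (n + 1)) hodd heven]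
  have hI : modifiedBesselI (k + 1 / 2) x =
      (x / 2) ^ ((k : ℝ) - 1 / 2) * ∑' m, b (2 * m + 1) := by
    rw [modifiedBesselI_eq hx, hb]
  have hL : modifiedStruveL (k + 1 / 2) x =
      (x / 2) ^ ((k : ℝ) - 1 / 2) * ∑' m, b (2 * m + 1 + 1) := by
    rw [modifiedStruveL_eq hx, hb]
  have hb0 : b 0 = 1 / (√Real.pi * Real.Gamma (k + 1)) := by
    rw [hb]
    simp [← Real.Gamma_one_half_eq]
  have hpow : (2 / x) ^ ((k : ℝ) - 1 / 2) * (x / 2) ^ ((k : ℝ) - 1 / 2) = 1 := by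
    rw [← Real.mul_rpow (by positivity) (by positivity)]
    have : 2 / x * (x / 2) = 1 := by field_simp
    rw [this, Real.one_rpow]
  have hval : ∑' n, b n = (2 / x) ^ ((k : ℝ) - 1 / 2) *
      (modifiedBesselI (k + 1 / 2) x + modifiedStruveL (k + 1 / 2) x) +
        1 / (√Real.pi * Real.Gamma (k + 1)) := by
    rw [htsum, hI, hL, hb0]
    linear_combination (∑' m, b (2 * m + 1) + ∑' m, b (2 * m + 1 + 1)) * -hpow
  rw [← hval]
  exact hbs.hasSum.mul_left _

end

theorem theorem4
    {Ω₀ Ω₁ : Type*} [MeasurableSpace Ω₀] [MeasurableSpace Ω₁]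
    (P₀ : Measure Ω₀) [IsProbabilityMeasure P₀]
    (P₁ : Measure Ω₁) [IsProbabilityMeasure P₁]
    (c lam t : ℝ) (hc : 0 < c) (hlam : 0 < lam) (ht : 0 < t)
    (X₀ : ℝ → Ω₀ → ℝ) (hX₀ : IsMotion 0 c lam X₀ P₀)
    (X₁ : ℝ → Ω₁ → ℝ) (hX₁ : IsMotion 1 c lam X₁ P₁)
    (p : ℕ) :
    Integrable (fun ω => X₀ t ω ^ p) P₀ ∧
    Integrable (fun ω => X₁ t ω ^ p) P₁ ∧
    (Even p →
      ∫ ω, X₀ t ω ^ p ∂P₀ =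
        Real.exp (-(lam * t)) * (2 / (lam * t)) ^ (((p : ℝ) - 1) / 2) * (c * t) ^ p *
            Real.Gamma (((p : ℝ) + 1) / 2) *
            (modifiedBesselI (((p : ℝ) + 1) / 2) (lam * t) +
              modifiedStruveL (((p : ℝ) + 1) / 2) (lam * t)) +
          Real.exp (-(lam * t)) * (c * t) ^ p * Real.Gamma (((p : ℝ) + 1) / 2) /
            (√Real.pi * Real.Gamma ((p : ℝ) / 2 + 1)) ∧
      ∫ ω, X₁ t ω ^ p ∂P₁ =
        Real.exp (-(lam * t)) / √Real.pi * Real.Gamma (((p : ℝ) + 1) / 2) * (c * t) ^ p *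
          (mittagLeffler 1 ((p : ℝ) / 2 + 1) (lam * t) -
            (p : ℝ) / 2 * mittagLeffler 1 ((p : ℝ) / 2 + 2) (lam * t))) ∧
    (Odd p →
      ∫ ω, X₀ t ω ^ p ∂P₀ = 0 ∧ ∫ ω, X₁ t ω ^ p ∂P₁ = 0) := by
  obtain ⟨hi₀, hs₀⟩ := hX₀.integrable_and_hasSum hc.le hlam ht p
  obtain ⟨hi₁, hs₁⟩ := hX₁.integrable_and_hasSum hc.le hlam ht p
  have hx : 0 < lam * t := mul_pos hlam ht
  refine ⟨hi₀, hi₁, ?_, ?_⟩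
  · rintro ⟨k, rfl⟩
    rw [← two_mul] at hs₀ hs₁ ⊢
    have e1 : (((2 * k : ℕ) : ℝ) + 1) / 2 = k + 1 / 2 := by push_cast; ring
    have e2 : (((2 * k : ℕ) : ℝ) - 1) / 2 = k - 1 / 2 := by push_cast; ring
    have e3 : ((2 * k : ℕ) : ℝ) / 2 = k := by push_cast; ring
    rw [e1, e2, e3]
    constructor
    · have hK : Real.exp (-(lam * t)) * (c * t) ^ (2 * k) ≠ 0 := by positivity
      -- Summability comes from the probabilistic series `hs₀`, divided by its nonzero prefactor.
      have h := (hasSum_directionSeries_zero hx k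
        ((summable_mul_left_iff hK).1 hs₀.summable)).mul_left
          (Real.exp (-(lam * t)) * (c * t) ^ (2 * k))
      rw [hs₀.unique h]
      ring
    · have h := (hasSum_directionSeries_one hx.le k).mul_left
        (Real.exp (-(lam * t)) * (c * t) ^ (2 * k))
      rw [hs₁.unique h]
      ring
  · rintro ⟨k, rfl⟩
    simp only [coeff_directionSeries_zero_pow_of_odd, coeff_directionSeries_one_pow_of_odd,
      mul_zero] at hs₀ hs₁
    exact ⟨hs₀.unique hasSum_zero, hs₁.unique hasSum_zero⟩
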